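/- Let $\tilde{\mathbb C}=\mathbb C\cup\{\infty\}$ be the Riemann sphere, with the chordal metric, and let $R=P/Q$ be a rational map of $\tilde{\mathbb C}$ to itself, where $P$ and $Q$ are coprime complex polynomials, of degree $\max(\deg P,\deg Q)\ge 2$. Write $R^n$ for the $n$-fold composition of $R$ with itself. The Fatou set $F(R)$ is the set of points of $\tilde{\mathbb C}$ that have an open neighbourhood $U$ on which the family $\{R^n|_U : n\ge 1\}$ is normal, i.e. every sequence in the family has a subsequence converging uniformly, in the chordal metric, on each compact subset of $U$. The Julia set is $J(R)=\tilde{\mathbb C}\setminus F(R)$. A point $z\in\tilde{\mathbb C}$ is periodic if $R^n(z)=z$ for some $n\ge 1$. Then $$J(R)\subset\overline{\{\text{periodic points of }R\}},$$ the closure being taken in $\tilde{\mathbb C}$. -/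

import Mathlib

open OnePoint

namespace RationalDynamics

noncomputable section

/-- The Riemann sphere (extended complex plane) `ℂ ∪ {∞}`, with its topology as the one-point
compactification of the plane. -/
abbrev RiemannSphere : Type := OnePoint ℂ

/-- Stereographic projection of the extended complex plane onto the unit sphere of `ℝ³`:
`z = x + iy` goes to `(2x, 2y, |z|² - 1) / (|z|² + 1)`, and `∞` goes to `(0, 0, 1)`. -/
def stereo : RiemannSphere → EuclideanSpace ℝ (Fin 3)
  | ∞ => !₂[0, 0, 1]
  | (z : ℂ) => !₂[2 * z.re / (‖z‖ ^ 2 + 1), 2 * z.im / (‖z‖ ^ 2 + 1),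
      (‖z‖ ^ 2 - 1) / (‖z‖ ^ 2 + 1)]

/-- The chordal metric: Euclidean length of the chord joining the stereographic images. -/
def chordalDist (z w : RiemannSphere) : ℝ := dist (stereo z) (stereo w)

/-- The degree of `R = P / Q`, with `P`, `Q` coprime: the maximum of the degrees of `P`, `Q`.
(`RatFunc.num` and `RatFunc.denom` are coprime.) -/
def mapDegree (R : RatFunc ℂ) : ℕ := max R.num.natDegree R.denom.natDegree

/-- The self-map of the Riemann sphere given by `R = P / Q`. The poles go to `∞`; the value at
`∞` is `∞` when `deg P > deg Q`, and otherwise the quotient of the coefficients of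
`z ^ (deg Q)` in `P` and in `Q`. -/
def sphereMap (R : RatFunc ℂ) : RiemannSphere → RiemannSphere
  | ∞ => if R.denom.natDegree < R.num.natDegree then ∞
      else ((R.num.coeff R.denom.natDegree / R.denom.leadingCoeff : ℂ) : RiemannSphere)
  | (z : ℂ) => if R.denom.eval z = 0 then ∞
      else ((R.num.eval z / R.denom.eval z : ℂ) : RiemannSphere)

/-- The family `F` is normal on the set `U`: every sequence in `F` has a subsequence which
converges, in the chordal metric, uniformly on each compact subset of `U`. -/
def IsNormalOn (F : Set (RiemannSphere → RiemannSphere)) (U : Set RiemannSphere) : Prop :=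
  ∀ f : ℕ → RiemannSphere → RiemannSphere, (∀ n, f n ∈ F) →
    ∃ φ : ℕ → ℕ, StrictMono φ ∧ ∃ g : RiemannSphere → RiemannSphere,
      ∀ K ⊆ U, IsCompact K → ∀ ε > (0 : ℝ), ∃ N : ℕ, ∀ j ≥ N, ∀ z ∈ K,
        chordalDist (f (φ j) z) (g z) < ε

/-- The family of iterates `R, R², R³, …` on the sphere. -/
def iterates (R : RatFunc ℂ) : Set (RiemannSphere → RiemannSphere) :=
  {f | ∃ n : ℕ, 1 ≤ n ∧ f = (sphereMap R)^[n]}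

/-- The Fatou set: the points having an open neighbourhood on which the iterates are a normal
family. -/
def fatouSet (R : RatFunc ℂ) : Set RiemannSphere :=
  {z | ∃ U : Set RiemannSphere, IsOpen U ∧ z ∈ U ∧ IsNormalOn (iterates R) U}

/-- The Julia set: the complement of the Fatou set. -/
def juliaSet (R : RatFunc ℂ) : Set RiemannSphere := (fatouSet R)ᶜ

end

end RationalDynamics

namespace RationalDynamics

open Filter Topology

/-! Let W be the complement of the closure of the periodic points. By Arzelà–Ascoli it suffices that
the iterates of R are equicontinuous at each q in W (`equicontinuousAt_iterates`).

Choose y with R²(y) = q and let y vary in a chart with parameter t. As long as w = R²(y) stays in W,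
it is not periodic. Hence y, R(y) and w are pairwise distinct, and every R^n(w) with n ≥ 1 avoids
all three: any coincidence, after applying R at most twice, makes w periodic. Montel's theorem with
these three moving targets (`equicontinuousAt_proj`) gives equicontinuity in t, and openness of R
carries it down to q. Since no local inverse of R² is taken, critical values need no separate
treatment.

Montel's theorem itself reduces, through the cross ratio with the three targets, to functions
omitting 0, 1 and ∞. For these, a Schwarz–Ahlfors argument with Robinson's explicit metric on ℂ ∖
{0, 1}, whose curvature is bounded above by a negative constant, bounds the spherical derivative
(`exists_norm_deriv_le`). This is a Lipschitz bound for the chordal metric, uniform over the family.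
-/

/-! ### Laplacians of logarithms at a maximum. -/

/-- `F` has derivative `F'` near `x`, and `F'` has derivative `a` at `x`. -/
def HasSecondDerivAt {E : Type*} [NormedAddCommGroup E] [NormedSpace ℝ E]
    (F : ℝ → E) (F' : ℝ → E) (a : E) (x : ℝ) : Prop :=
  (∀ᶠ t in 𝓝 x, HasDerivAt F (F' t) t) ∧ HasDerivAt F' a x

theorem HasSecondDerivAt.add {E : Type*} [NormedAddCommGroup E] [NormedSpace ℝ E]
    {F F' G G' : ℝ → E} {a b : E} {x : ℝ} (hF : HasSecondDerivAt F F' a x)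
    (hG : HasSecondDerivAt G G' b x) :
    HasSecondDerivAt (fun t => F t + G t) (fun t => F' t + G' t) (a + b) x := by
  refine ⟨?_, hF.2.add hG.2⟩
  filter_upwards [hF.1, hG.1] with t h₁ h₂ using h₁.add h₂

/-- If `a` were positive, `x` would be a local minimum as well as a local maximum, so `F` would be
locally constant and `a` would be zero. -/
theorem HasSecondDerivAt.nonpos_of_isLocalMax {F F' : ℝ → ℝ} {a x : ℝ}
    (hF : HasSecondDerivAt F F' a x) (hmax : IsLocalMax F x) : a ≤ 0 := by
  by_contra! ha
  have hd : deriv F =ᶠ[𝓝 x] F' := hF.1.mono fun t ht => ht.deriv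
  have h1 : deriv (deriv F) x = a := by rw [hd.deriv_eq, hF.2.deriv]
  have hmin : IsLocalMin F x :=
    isLocalMin_of_deriv_deriv_pos (by rw [h1]; exact ha) hmax.deriv_eq_zero
      hF.1.self_of_nhds.continuousAt
  have hc : F =ᶠ[𝓝 x] fun _ => F x := by
    filter_upwards [hmax, hmin] with t h₁ h₂ using le_antisymm h₁ h₂
  have h0 : deriv F =ᶠ[𝓝 x] fun _ => 0 := by
    filter_upwards [hc.eventuallyEq_nhds] with t ht
    rw [ht.deriv_eq, deriv_const]
  rw [h0.deriv_eq, deriv_const] at h1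
  exact ha.ne h1

/-- The second derivative of `log (c + ε ‖γ‖²)` along a curve. -/
theorem HasSecondDerivAt.log_add_norm_sq {E : Type*} [NormedAddCommGroup E] [InnerProductSpace ℝ E]
    {γ γ' : ℝ → E} {γ'' : E} {x : ℝ} (hγ : HasSecondDerivAt γ γ' γ'' x) (c ε : ℝ)
    (hpos : 0 < c + ε * ‖γ x‖ ^ 2) :
    HasSecondDerivAt (fun t => Real.log (c + ε * ‖γ t‖ ^ 2))
      (fun t => ε * (2 * inner ℝ (γ t) (γ' t)) / (c + ε * ‖γ t‖ ^ 2))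
      ((ε * (2 * (inner ℝ (γ x) γ'' + ‖γ' x‖ ^ 2)) * (c + ε * ‖γ x‖ ^ 2)
        - (ε * (2 * inner ℝ (γ x) (γ' x))) * (ε * (2 * inner ℝ (γ x) (γ' x))))
        / (c + ε * ‖γ x‖ ^ 2) ^ 2) x := by
  have hN : ∀ t, HasDerivAt γ (γ' t) t →
      HasDerivAt (fun t => c + ε * ‖γ t‖ ^ 2) (ε * (2 * inner ℝ (γ t) (γ' t))) t := fun t ht =>
    (ht.norm_sq.const_mul ε).const_add c
  have h0 := hγ.1.self_of_nhds
  constructor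
  · have hev : ∀ᶠ t in 𝓝 x, 0 < c + ε * ‖γ t‖ ^ 2 :=
      (hN x h0).continuousAt.eventually (lt_mem_nhds hpos)
    filter_upwards [hγ.1, hev] with t ht hp using (hN t ht).log hp.ne'
  · have := (((h0.inner ℝ hγ.2).const_mul 2).const_mul ε).div (hN x h0) hpos.ne'
    rw [real_inner_self_eq_norm_sq] at this
    exact this

theorem hasSecondDerivAt_line {h : ℂ → ℂ} {z : ℂ} (hh : AnalyticAt ℂ h z) (v : ℂ) :
    HasSecondDerivAt (fun t : ℝ => h (z + t * v)) (fun t : ℝ => deriv h (z + t * v) * v)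
      (deriv (deriv h) z * v * v) 0 := by
  have hl : ∀ t : ℝ, HasDerivAt (fun t : ℝ => z + t * v) v t := fun t => by
    simpa using ((Complex.ofRealCLM.hasDerivAt (x := t)).mul_const v).const_add z
  have hcomp : ∀ (g : ℂ → ℂ) (t : ℝ), DifferentiableAt ℂ g (z + t * v) →
      HasDerivAt (fun t : ℝ => g (z + t * v)) (deriv g (z + t * v) * v) t := fun g t hg =>
    HasDerivAt.comp (𝕜 := ℝ) (𝕜' := ℂ) t hg.hasDerivAt (hl t)
  constructor
  · have : Tendsto (fun t : ℝ => z + t * v) (𝓝 0) (𝓝 z) := by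
      simpa using (hl 0).continuousAt.tendsto
    filter_upwards [this.eventually hh.eventually_analyticAt] with t ht
    exact hcomp h t ht.differentiableAt
  · have := (hcomp (deriv h) 0 (by simpa using hh.deriv.differentiableAt)).mul_const v
    simpa using this

theorem HasSecondDerivAt.two_mul_re {γ γ' : ℝ → ℂ} {γ'' : ℂ} {x : ℝ} (hγ : HasSecondDerivAt γ γ' γ'' x) :
    HasSecondDerivAt (fun t => 2 * (γ t).re) (fun t => 2 * (γ' t).re) (2 * γ''.re) x := by
  refine ⟨?_, (Complex.reCLM.hasFDerivAt.comp_hasDerivAt x hγ.2).const_mul 2⟩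
  filter_upwards [hγ.1] with t ht
  exact (Complex.reCLM.hasFDerivAt.comp_hasDerivAt t ht).const_mul 2

/-- Adding the second derivatives in the directions 1 and `I` gives the Laplacian of log (c +
ε|p|²); the terms in `p''` cancel because I² = -1. -/
theorem laplacian_log_add_norm_sq (c ε : ℝ) (p p' p'' : ℂ) :
    (ε * (2 * (inner ℝ p (p'' * 1 * 1) + ‖p' * 1‖ ^ 2)) * (c + ε * ‖p‖ ^ 2)
        - (ε * (2 * inner ℝ p (p' * 1))) * (ε * (2 * inner ℝ p (p' * 1))))
        / (c + ε * ‖p‖ ^ 2) ^ 2 +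
    (ε * (2 * (inner ℝ p (p'' * Complex.I * Complex.I) + ‖p' * Complex.I‖ ^ 2))
        * (c + ε * ‖p‖ ^ 2)
        - (ε * (2 * inner ℝ p (p' * Complex.I))) * (ε * (2 * inner ℝ p (p' * Complex.I))))
        / (c + ε * ‖p‖ ^ 2) ^ 2 = 4 * ε * c * ‖p'‖ ^ 2 / (c + ε * ‖p‖ ^ 2) ^ 2 := by
  rw [← add_div]
  congr 1
  simp only [Complex.inner, Complex.sq_norm, Complex.normSq_apply, Complex.mul_re, Complex.mul_im,
    Complex.conj_re, Complex.conj_im, Complex.I_re, Complex.I_im, Complex.one_re, Complex.one_im]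
  ring

/-- At a maximum the second derivatives along 1 and `I` are nonpositive, hence so is the Laplacian.
The harmonic term `2 * (L w).re` drops out, the two copies of log (r² - |w|²) contribute -8r²/(r² -
|z|²)², and the result is divided by 4. -/
theorem laplacian_le_of_isLocalMax {h k L : ℂ → ℂ} {z : ℂ} {r : ℝ} (hh : AnalyticAt ℂ h z)
    (hk : AnalyticAt ℂ k z) (hL : AnalyticAt ℂ L z) (hz : 0 < r ^ 2 - ‖z‖ ^ 2)
    (hmax : IsLocalMax (fun w => Real.log (r ^ 2 + (-1) * ‖w‖ ^ 2)
      + Real.log (r ^ 2 + (-1) * ‖w‖ ^ 2)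
      + Real.log (1 + 1 * ‖h w‖ ^ 2) + Real.log (1 + 1 * ‖k w‖ ^ 2) + 2 * (L w).re) z) :
    ‖deriv h z‖ ^ 2 / (1 + ‖h z‖ ^ 2) ^ 2 + ‖deriv k z‖ ^ 2 / (1 + ‖k z‖ ^ 2) ^ 2
      ≤ 2 * r ^ 2 / (r ^ 2 - ‖z‖ ^ 2) ^ 2 := by
  have hh' : 0 < 1 + 1 * ‖h z‖ ^ 2 := by positivity
  have hk' : 0 < 1 + 1 * ‖k z‖ ^ 2 := by positivity
  have key := fun v : ℂ =>
    have e : z + ((0 : ℝ) : ℂ) * v = z := by simp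
    have d1 := (hasSecondDerivAt_line (analyticAt_id (𝕜 := ℂ) (z := z)) v).log_add_norm_sq
      (r ^ 2) (-1) (by simpa using hz)
    have d2 := (hasSecondDerivAt_line hh v).log_add_norm_sq 1 1 (by rw [e]; exact hh')
    have d3 := (hasSecondDerivAt_line hk v).log_add_norm_sq 1 1 (by rw [e]; exact hk')
    have d4 := (hasSecondDerivAt_line hL v).two_mul_re
    have hm : IsLocalMax ((fun w => Real.log (r ^ 2 + (-1) * ‖w‖ ^ 2)
      + Real.log (r ^ 2 + (-1) * ‖w‖ ^ 2)
      + Real.log (1 + 1 * ‖h w‖ ^ 2) + Real.log (1 + 1 * ‖k w‖ ^ 2) + 2 * (L w).re) ∘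
        fun t : ℝ => z + t * v) 0 := by
      apply IsMaxFilter.comp_tendsto (l := 𝓝 z)
      · rw [e]; exact hmax
      · have : Continuous fun t : ℝ => z + t * v := by fun_prop
        simpa using this.tendsto 0
    ((((d1.add d1).add d2).add d3).add d4).nonpos_of_isLocalMax hm
  have k1 := key 1
  have kI := key Complex.I
  simp only [Complex.ofReal_zero, zero_mul, add_zero, id_eq] at k1 kI
  have e1 := laplacian_log_add_norm_sq (r ^ 2) (-1) z (deriv id z) (deriv (deriv id) z)
  have e2 := laplacian_log_add_norm_sq 1 1 (h z) (deriv h z) (deriv (deriv h) z)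
  have e3 := laplacian_log_add_norm_sq 1 1 (k z) (deriv k z) (deriv (deriv k) z)
  have e4 : 2 * (deriv (deriv L) z * 1 * 1).re +
      2 * (deriv (deriv L) z * Complex.I * Complex.I).re = 0 := by
    rw [mul_assoc (deriv (deriv L) z) Complex.I, Complex.I_mul_I]; simp
  have hs : 2 * (4 * (-1) * r ^ 2 * ‖deriv (id : ℂ → ℂ) z‖ ^ 2
      / (r ^ 2 + (-1) * ‖z‖ ^ 2) ^ 2)
      + 4 * 1 * 1 * ‖deriv h z‖ ^ 2 / (1 + 1 * ‖h z‖ ^ 2) ^ 2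
      + 4 * 1 * 1 * ‖deriv k z‖ ^ 2 / (1 + 1 * ‖k z‖ ^ 2) ^ 2 ≤ 0 := by
    rw [← e1, ← e2, ← e3]
    linarith
  rw [deriv_id, norm_one, one_pow] at hs
  have n1 : r ^ 2 + (-1) * ‖z‖ ^ 2 = r ^ 2 - ‖z‖ ^ 2 := by ring
  rw [n1, one_mul, one_mul] at hs
  simp only [div_eq_mul_inv] at hs ⊢
  linarith

/-! ### Robinson's metric on ℂ ∖ {0, 1} and the Schwarz–Ahlfors bound. -/

theorem exists_analyticAt_exp_eq {G : ℂ → ℂ} {z : ℂ} (hG : AnalyticAt ℂ G z) (h0 : G z ≠ 0) :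
    ∃ L : ℂ → ℂ, AnalyticAt ℂ L z ∧ ∀ᶠ w in 𝓝 z, Complex.exp (L w) = G w := by
  refine ⟨fun w => Complex.log (G w / G z) + Complex.log (G z),
    ((hG.div analyticAt_const h0).clog ?_).add analyticAt_const, ?_⟩
  · simp [h0]
  · filter_upwards [hG.continuousAt.eventually_ne h0] with w hw
    rw [Complex.exp_add, Complex.exp_log (div_ne_zero hw h0), Complex.exp_log h0,
      div_mul_cancel₀ _ h0]

theorem exists_analyticAt_pow_six_eq {G : ℂ → ℂ} {z : ℂ} (hG : AnalyticAt ℂ G z) (h0 : G z ≠ 0) :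
    ∃ h : ℂ → ℂ, AnalyticAt ℂ h z ∧ ∀ᶠ w in 𝓝 z, h w ^ 6 = G w := by
  obtain ⟨L, hL, hLG⟩ := exists_analyticAt_exp_eq hG h0
  refine ⟨fun w => Complex.exp (L w / 6), (hL.div analyticAt_const (by norm_num)).cexp, ?_⟩
  filter_upwards [hLG] with w hw
  rw [← Complex.exp_nat_mul, ← hw]
  congr 1
  push_cast
  ring

/-- From y ≥ 1/2 come 1 + x ≤ 2 + y ≤ 5y and 1 + y ≤ 3y; then (5y)³ · 3y = 375y⁴ ≤ 750y⁵. -/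
theorem robinson_curvature_aux {x y : ℝ} (hx : 0 < x) (hy : 1 / 2 ≤ y) (hxy : x ≤ 1 + y) :
    (1 + x) * (1 + y) / (x ^ 5 * y ^ 5) ≤ 750 * (1 / (x ^ 5 * (1 + x) ^ 2)) := by
  have hy0 : 0 < y := by linarith
  rw [← mul_div_assoc, div_le_div_iff₀ (by positivity) (by positivity)]
  have h1 : (1 + x) ^ 3 ≤ (5 * y) ^ 3 := by gcongr; linarith
  have h2 : (1 + x) ^ 3 * (1 + y) ≤ (5 * y) ^ 3 * (3 * y) := by gcongr; linarith
  have h3 : (5 * y) ^ 3 * (3 * y) ≤ 750 * y ^ 5 := by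
    have : 0 ≤ 375 * y ^ 4 * (2 * y - 1) := by
      have : 0 ≤ 2 * y - 1 := by linarith
      positivity
    linarith
  calc (1 + x) * (1 + y) * (x ^ 5 * (1 + x) ^ 2) = x ^ 5 * ((1 + x) ^ 3 * (1 + y)) := by ring
    _ ≤ x ^ 5 * (750 * y ^ 5) := mul_le_mul_of_nonneg_left (h2.trans h3) (by positivity)
    _ = 750 * 1 * (x ^ 5 * y ^ 5) := by ring

/-- The negative curvature of the metric, with x = |f|^(1/3) and y = |f - 1|^(1/3). As x³ + y³ ≥ 1,
one of the two is at least 1/2, and then the term of the other one suffices. -/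
theorem robinson_curvature {x y : ℝ} (hx : 0 < x) (hy : 0 < y) (h1 : 1 ≤ x ^ 3 + y ^ 3)
    (hxy : x ≤ 1 + y) (hyx : y ≤ 1 + x) :
    (1 + x) * (1 + y) / (x ^ 5 * y ^ 5) ≤
      750 * (1 / (x ^ 5 * (1 + x) ^ 2) + 1 / (y ^ 5 * (1 + y) ^ 2)) := by
  have px : 0 < 1 / (x ^ 5 * (1 + x) ^ 2) := by positivity
  have py : 0 < 1 / (y ^ 5 * (1 + y) ^ 2) := by positivity
  by_cases h : 1 / 2 ≤ y
  · linarith [robinson_curvature_aux hx h hxy]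
  · have hx2 : 1 / 2 ≤ x := by
      by_contra! h'
      push Not at h
      have a1 : x ^ 3 < (1 / 2) ^ 3 := by gcongr
      have a2 : y ^ 3 < (1 / 2) ^ 3 := by gcongr
      norm_num at a1 a2
      linarith
    have := robinson_curvature_aux hy hx2 hyx
    rw [mul_comm (1 + y), mul_comm (y ^ 5)] at this
    linarith

/-- The cube root of the modulus. -/
noncomputable def cubeRootNorm (w : ℂ) : ℝ := ‖w‖ ^ ((3 : ℕ) : ℝ)⁻¹

theorem cubeRootNorm_pow (w : ℂ) : cubeRootNorm w ^ 3 = ‖w‖ :=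
  Real.rpow_inv_natCast_pow (norm_nonneg w) (by norm_num)

theorem cubeRootNorm_pos {w : ℂ} (hw : w ≠ 0) : 0 < cubeRootNorm w :=
  Real.rpow_pos_of_pos (norm_pos_iff.2 hw) _

theorem continuous_cubeRootNorm : Continuous cubeRootNorm :=
  continuous_norm.rpow_const fun _ => Or.inr (by positivity)

theorem cubeRootNorm_pow_six (h : ℂ) : cubeRootNorm (h ^ 6) = ‖h‖ ^ 2 := by
  rw [cubeRootNorm, norm_pow, show (6 : ℕ) = 2 * 3 by norm_num, pow_mul]
  exact Real.pow_rpow_inv_natCast (by positivity) (by norm_num)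

theorem cubeRootNorm_le_one_add {w v : ℂ} (h : ‖w‖ ≤ 1 + ‖v‖) :
    cubeRootNorm w ≤ 1 + cubeRootNorm v := by
  have hw : 0 ≤ cubeRootNorm w := by unfold cubeRootNorm; positivity
  have hv : 0 ≤ cubeRootNorm v := by unfold cubeRootNorm; positivity
  rw [← cubeRootNorm_pow, ← cubeRootNorm_pow] at h
  refine le_of_pow_le_pow_left₀ (n := 3) (by norm_num) (by positivity) ?_
  nlinarith [mul_nonneg hv hv]

/-- The square of the pullback of Robinson's metric on `ℂ ∖ {0, 1}`. -/
noncomputable def robinsonSq (f : ℂ → ℂ) (z : ℂ) : ℝ :=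
  (1 + cubeRootNorm (f z)) * (1 + cubeRootNorm (f z - 1)) * ‖deriv f z‖ ^ 2 /
    (cubeRootNorm (f z) ^ 5 * cubeRootNorm (f z - 1) ^ 5)

/-- Locally f = h⁶, f - 1 = k⁶ and f'/(h⁵k⁵) = exp L. Sixth roots turn |f|^(1/3) into |h|², so the
logarithm of the maximised function has the form handled by `laplacian_le_of_isLocalMax`. -/
theorem robinsonSq_le_of_isLocalMax {f : ℂ → ℂ} {z : ℂ} {r : ℝ} (hf : AnalyticAt ℂ f z)
    (h0 : f z ≠ 0) (h1 : f z ≠ 1) (hz : 0 < r ^ 2 - ‖z‖ ^ 2)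
    (hmax : IsLocalMax (fun w => (r ^ 2 - ‖w‖ ^ 2) ^ 2 * robinsonSq f w) z) :
    (r ^ 2 - ‖z‖ ^ 2) ^ 2 * robinsonSq f z ≤ 54000 * r ^ 2 := by
  have h1' : f z - 1 ≠ 0 := sub_ne_zero.2 h1
  -- At a critical point there is no logarithm of f', but the left side is zero.
  by_cases hd : deriv f z = 0
  · simp only [robinsonSq, hd, norm_zero]
    norm_num
    positivity
  obtain ⟨h, hh, hhf⟩ := exists_analyticAt_pow_six_eq hf h0
  obtain ⟨k, hk, hkf⟩ := exists_analyticAt_pow_six_eq (hf.sub analyticAt_const) h1'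
  have hhz := hhf.self_of_nhds
  have hkz := hkf.self_of_nhds
  simp only [Pi.sub_apply] at hkf hkz
  have hne : h z ≠ 0 := fun e => h0 (by rw [← hhz, e]; norm_num)
  have kne : k z ≠ 0 := fun e => h1' (by rw [← hkz, e]; norm_num)
  have hP : h z ^ 5 * k z ^ 5 ≠ 0 := by positivity
  obtain ⟨L, hL, hLG⟩ := exists_analyticAt_exp_eq
    (hf.deriv.div ((hh.pow 5).mul (hk.pow 5)) hP) (div_ne_zero hd hP)
  have dh : 6 * h z ^ 5 * deriv h z = deriv f z := by
    have e : deriv (fun w => h w ^ 6) z = deriv f z := Filter.EventuallyEq.deriv_eq hhf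
    rw [← e, deriv_fun_pow hh.differentiableAt]
    norm_num
  have dk : 6 * k z ^ 5 * deriv k z = deriv f z := by
    have e : deriv (fun w => k w ^ 6) z = deriv (fun w => f w - 1) z := Filter.EventuallyEq.deriv_eq hkf
    rw [deriv_sub_const] at e
    rw [← e, deriv_fun_pow hk.differentiableAt]
    norm_num
  have hcont : ContinuousAt (fun w : ℂ => r ^ 2 - ‖w‖ ^ 2) z := by fun_prop
  -- near `z` the maximised function is the exponential of a sum of logarithms
  have hexp : ∀ᶠ w in 𝓝 z, (r ^ 2 - ‖w‖ ^ 2) ^ 2 * robinsonSq f w =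
      Real.exp (Real.log (r ^ 2 + (-1) * ‖w‖ ^ 2) + Real.log (r ^ 2 + (-1) * ‖w‖ ^ 2)
      + Real.log (1 + 1 * ‖h w‖ ^ 2) + Real.log (1 + 1 * ‖k w‖ ^ 2) + 2 * (L w).re) := by
    filter_upwards [hhf, hkf, hLG, hcont.eventually (lt_mem_nhds hz)] with w w1 w2 w3 w4
    have e5 : Real.exp (2 * (L w).re) = ‖deriv f w‖ ^ 2 / (‖h w‖ ^ 10 * ‖k w‖ ^ 10) := by
      rw [two_mul, Real.exp_add, ← Complex.norm_exp, w3]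
      simp only [Pi.div_apply, Pi.mul_apply, Pi.pow_apply, norm_div, norm_mul, norm_pow]
      rw [div_mul_div_comm]
      congr 1 <;> ring
    have e1 : r ^ 2 + (-1) * ‖w‖ ^ 2 = r ^ 2 - ‖w‖ ^ 2 := by ring
    rw [e1, Real.exp_add, Real.exp_add, Real.exp_add, Real.exp_add, Real.exp_log w4,
      Real.exp_log (by positivity), Real.exp_log (by positivity), e5, robinsonSq, ← w2, ← w1,
      cubeRootNorm_pow_six, cubeRootNorm_pow_six]
    ring
  have hmax' : IsLocalMax (fun w => Real.log (r ^ 2 + (-1) * ‖w‖ ^ 2)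
      + Real.log (r ^ 2 + (-1) * ‖w‖ ^ 2)
      + Real.log (1 + 1 * ‖h w‖ ^ 2) + Real.log (1 + 1 * ‖k w‖ ^ 2) + 2 * (L w).re) z := by
    filter_upwards [hmax, hexp] with w w1 w2
    rw [w2, hexp.self_of_nhds, Real.exp_le_exp] at w1
    exact w1
  have key := laplacian_le_of_isLocalMax hh hk hL hz hmax'
  set M := r ^ 2 - ‖z‖ ^ 2
  set x := cubeRootNorm (f z) with hx
  set y := cubeRootNorm (f z - 1) with hy
  have hxh : x = ‖h z‖ ^ 2 := by rw [hx, ← hhz, cubeRootNorm_pow_six]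
  have hyk : y = ‖k z‖ ^ 2 := by rw [hy, ← hkz, cubeRootNorm_pow_six]
  have x0 : 0 < x := cubeRootNorm_pos h0
  have y0 : 0 < y := cubeRootNorm_pos h1'
  have eh : ‖deriv h z‖ ^ 2 / (1 + ‖h z‖ ^ 2) ^ 2 =
      ‖deriv f z‖ ^ 2 / 36 * (1 / (x ^ 5 * (1 + x) ^ 2)) := by
    rw [← dh, hxh]
    simp only [norm_mul, norm_pow]
    have : ‖h z‖ ≠ 0 := by simpa using hne
    norm_num
    field_simp
    ring
  have ek : ‖deriv k z‖ ^ 2 / (1 + ‖k z‖ ^ 2) ^ 2 =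
      ‖deriv f z‖ ^ 2 / 36 * (1 / (y ^ 5 * (1 + y) ^ 2)) := by
    rw [← dk, hyk]
    simp only [norm_mul, norm_pow]
    have : ‖k z‖ ≠ 0 := by simpa using kne
    norm_num
    field_simp
    ring
  rw [eh, ek, ← mul_add, le_div_iff₀ (by positivity)] at key
  have hcurv : (1 + x) * (1 + y) / (x ^ 5 * y ^ 5) ≤
      750 * (1 / (x ^ 5 * (1 + x) ^ 2) + 1 / (y ^ 5 * (1 + y) ^ 2)) := by
    refine robinson_curvature x0 y0 ?_ (cubeRootNorm_le_one_add ?_) (cubeRootNorm_le_one_add ?_)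
    · rw [hx, hy, cubeRootNorm_pow, cubeRootNorm_pow]
      simpa using norm_sub_le (f z) (f z - 1)
    · simpa using norm_add_le 1 (f z - 1)
    · simpa [add_comm] using norm_sub_le (f z) 1
  calc M ^ 2 * robinsonSq f z
      = M ^ 2 * ‖deriv f z‖ ^ 2 * ((1 + x) * (1 + y) / (x ^ 5 * y ^ 5)) := by
        rw [robinsonSq]; ring
    _ ≤ M ^ 2 * ‖deriv f z‖ ^ 2 *
        (750 * (1 / (x ^ 5 * (1 + x) ^ 2) + 1 / (y ^ 5 * (1 + y) ^ 2))) := by gcongr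
    _ = 27000 * (‖deriv f z‖ ^ 2 / 36 *
        (1 / (x ^ 5 * (1 + x) ^ 2) + 1 / (y ^ 5 * (1 + y) ^ 2)) * M ^ 2) := by ring
    _ ≤ 27000 * (2 * r ^ 2) := by gcongr
    _ = 54000 * r ^ 2 := by ring

/-- The weight r² - |z|² vanishes on the boundary circle, so the maximum over the closed disc is
either interior, where the local estimate applies, or zero. -/
theorem robinsonSq_le {f : ℂ → ℂ} {r R : ℝ} (hr : 0 < r) (hrR : r < R)
    (hf : DifferentiableOn ℂ f (Metric.ball 0 R)) (h0 : ∀ z ∈ Metric.ball (0 : ℂ) R, f z ≠ 0)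
    (h1 : ∀ z ∈ Metric.ball (0 : ℂ) R, f z ≠ 1) {z : ℂ} (hz : ‖z‖ ≤ r) :
    (r ^ 2 - ‖z‖ ^ 2) ^ 2 * robinsonSq f z ≤ 54000 * r ^ 2 := by
  have hsub : Metric.closedBall (0 : ℂ) r ⊆ Metric.ball 0 R :=
    Metric.closedBall_subset_ball hrR
  have hcf : ContinuousOn f (Metric.closedBall 0 r) := hf.continuousOn.mono hsub
  have hcd : ContinuousOn (deriv f) (Metric.closedBall 0 r) :=
    (hf.deriv Metric.isOpen_ball).continuousOn.mono hsub
  have hx : ContinuousOn (fun w => cubeRootNorm (f w)) (Metric.closedBall 0 r) :=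
    continuous_cubeRootNorm.comp_continuousOn hcf
  have hy : ContinuousOn (fun w => cubeRootNorm (f w - 1)) (Metric.closedBall 0 r) :=
    continuous_cubeRootNorm.comp_continuousOn (hcf.sub continuousOn_const)
  have hc : ContinuousOn (fun w => (r ^ 2 - ‖w‖ ^ 2) ^ 2 * robinsonSq f w)
      (Metric.closedBall 0 r) := by
    refine ContinuousOn.mul (by fun_prop) (ContinuousOn.div (by fun_prop) (by fun_prop) ?_)
    intro w hw
    have a := cubeRootNorm_pos (h0 w (hsub hw))
    have b := cubeRootNorm_pos (sub_ne_zero.2 (h1 w (hsub hw)))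
    positivity
  obtain ⟨m, hm, hmax⟩ := (isCompact_closedBall (0 : ℂ) r).exists_isMaxOn
    ⟨0, by simp [hr.le]⟩ hc
  refine (hmax (by simpa using hz)).trans ?_
  have hmr : ‖m‖ ≤ r := by simpa using hm
  rcases hmr.lt_or_eq with hlt | heq
  · have hmb : m ∈ Metric.ball (0 : ℂ) R := hsub hm
    refine robinsonSq_le_of_isLocalMax (hf.analyticAt (Metric.isOpen_ball.mem_nhds hmb))
      (h0 m hmb) (h1 m hmb) ?_ (hmax.isLocalMax ?_)
    · have : ‖m‖ ^ 2 < r ^ 2 := by gcongr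
      linarith
    · exact mem_of_superset (Metric.isOpen_ball.mem_nhds (by simpa using hlt))
        Metric.ball_subset_closedBall
  · simp only [heq, sub_self]
    norm_num
    positivity

theorem exists_norm_deriv_le {R : ℝ} (hR : 0 < R) : ∃ C : ℝ, 0 ≤ C ∧ ∀ f : ℂ → ℂ,
    DifferentiableOn ℂ f (Metric.ball 0 R) → (∀ z ∈ Metric.ball (0 : ℂ) R, f z ≠ 0) →
    (∀ z ∈ Metric.ball (0 : ℂ) R, f z ≠ 1) → ∀ z ∈ Metric.ball (0 : ℂ) (R / 4),
      ‖deriv f z‖ ≤ C * (1 + ‖f z‖ ^ 2) := by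
  obtain ⟨r, rfl⟩ : ∃ r, R = 2 * r := ⟨R / 2, by ring⟩
  have hr : 0 < r := by linarith
  -- 16 comes from (1 + x)⁴ ≤ 16(1 + x⁶), where x⁶ = |f|²; 310 from 96000 ≤ 310², where 96000 =
  -- 54000 · (4/3)².
  refine ⟨16 * (310 / r), by positivity, fun f hf h0 h1 z hz => ?_⟩
  have hz' : ‖z‖ < 2 * r / 4 := by simpa using hz
  have hzb : z ∈ Metric.ball (0 : ℂ) (2 * r) := by simp; linarith
  have hU := robinsonSq_le hr (by linarith) hf h0 h1 (z := z) (by linarith)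
  have hM : 3 / 4 * r ^ 2 ≤ r ^ 2 - ‖z‖ ^ 2 := by
    have : ‖z‖ ^ 2 ≤ (2 * r / 4) ^ 2 := by gcongr
    linarith [this]
  have hx := cubeRootNorm_pos (h0 z hzb)
  have hy := cubeRootNorm_pos (sub_ne_zero.2 (h1 z hzb))
  have hx6 : ‖f z‖ ^ 2 = cubeRootNorm (f z) ^ 6 := by rw [← cubeRootNorm_pow]; ring
  have hyx : cubeRootNorm (f z - 1) ≤ 1 + cubeRootNorm (f z) :=
    cubeRootNorm_le_one_add (by simpa [add_comm] using norm_sub_le (f z) 1)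
  rw [hx6]
  unfold robinsonSq at hU
  set x := cubeRootNorm (f z)
  set y := cubeRootNorm (f z - 1)
  set D := ‖deriv f z‖
  have h2 : (3 / 4 * r ^ 2) ^ 2 * ((1 + x) * (1 + y) * D ^ 2 / (x ^ 5 * y ^ 5))
      ≤ 54000 * r ^ 2 := le_trans (by gcongr) hU
  rw [← mul_div_assoc, div_le_iff₀ (by positivity)] at h2
  have h3 : (r * D) ^ 2 * ((1 + x) * (1 + y)) ≤ 96000 * (x ^ 5 * y ^ 5) := by
    have hr2 : 0 < r ^ 2 := by positivity
    refine le_of_mul_le_mul_left ?_ hr2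
    linarith
  have h4 : 96000 * (x ^ 5 * y ^ 5) ≤ 96000 * (x ^ 4 * y ^ 4) * ((1 + x) * (1 + y)) := by
    have : 0 ≤ 96000 * (x ^ 4 * y ^ 4) * (1 + x + y) := by positivity
    linarith
  have h5 : (r * D) ^ 2 ≤ 96000 * (x ^ 4 * y ^ 4) :=
    le_of_mul_le_mul_right (h3.trans h4) (by positivity)
  have h6 : x ^ 4 * y ^ 4 ≤ ((1 + x) ^ 4) ^ 2 := by
    calc x ^ 4 * y ^ 4 ≤ (1 + x) ^ 4 * (1 + x) ^ 4 := by gcongr; linarith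
      _ = _ := by ring
  have h7 : (1 + x) ^ 4 ≤ 16 * (1 + x ^ 6) := by
    have a1 : (1 + x) ^ 4 ≤ 8 * (1 + x ^ 4) := by
      have := add_pow_le zero_le_one hx.le 4
      norm_num at this
      linarith
    have a2 : x ^ 4 ≤ 1 + 2 * x ^ 6 := by
      rcases le_total x 1 with hx1 | hx1
      · have := pow_le_one₀ (n := 4) hx.le hx1
        have : 0 < x ^ 6 := by positivity
        linarith
      · have := pow_le_pow_right₀ hx1 (show 4 ≤ 6 by norm_num)
        have : 0 < x ^ 6 := by positivity
        linarith
    linarith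
  have h8 : (r * D) ^ 2 ≤ (310 * (16 * (1 + x ^ 6))) ^ 2 := by
    calc (r * D) ^ 2 ≤ 96000 * ((1 + x) ^ 4) ^ 2 := h5.trans (by gcongr)
      _ ≤ 96000 * (16 * (1 + x ^ 6)) ^ 2 := by gcongr
      _ ≤ (310 * (16 * (1 + x ^ 6))) ^ 2 := by
        rw [mul_pow 310]
        gcongr
        norm_num
  have h9 := (pow_le_pow_iff_left₀ (by positivity) (by positivity) two_ne_zero).1 h8
  calc D = r * D / r := by field_simp
    _ ≤ 310 * (16 * (1 + x ^ 6)) / r := by gcongr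
    _ = 16 * (310 / r) * (1 + x ^ 6) := by ring

/-! ### The chordal metric. -/

/-- The stereographic image of z has planar part 2z/(1 + |z|²) and height 1 - 2/(1 + |z|²). -/
theorem chordalDist_coe_le (z w : ℂ) : chordalDist z w ≤
    ‖(2 / (1 + ‖z‖ ^ 2)) • z - (2 / (1 + ‖w‖ ^ 2)) • w‖ +
      |2 / (1 + ‖z‖ ^ 2) - 2 / (1 + ‖w‖ ^ 2)| := by
  unfold chordalDist
  rw [EuclideanSpace.dist_eq, Fin.sum_univ_three]
  refine Real.sqrt_le_iff.2 ⟨by positivity, ?_⟩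
  simp only [stereo, Real.dist_eq, sq_abs, Matrix.cons_val_zero, Matrix.cons_val_one,
    Matrix.cons_val]
  have hz : 0 < 1 + ‖z‖ ^ 2 := by positivity
  have hw : 0 < 1 + ‖w‖ ^ 2 := by positivity
  set X := (2 / (1 + ‖z‖ ^ 2)) • z - (2 / (1 + ‖w‖ ^ 2)) • w with hX
  have hn : ‖X‖ ^ 2 = X.re ^ 2 + X.im ^ 2 := by
    rw [Complex.sq_norm, Complex.normSq_apply]; ring
  have e1 : 2 * z.re / (‖z‖ ^ 2 + 1) - 2 * w.re / (‖w‖ ^ 2 + 1) = X.re := by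
    rw [hX, Complex.sub_re, Complex.smul_re, Complex.smul_re, smul_eq_mul, smul_eq_mul]; ring
  have e2 : 2 * z.im / (‖z‖ ^ 2 + 1) - 2 * w.im / (‖w‖ ^ 2 + 1) = X.im := by
    rw [hX, Complex.sub_im, Complex.smul_im, Complex.smul_im, smul_eq_mul, smul_eq_mul]; ring
  have e3 : (‖z‖ ^ 2 - 1) / (‖z‖ ^ 2 + 1) - (‖w‖ ^ 2 - 1) / (‖w‖ ^ 2 + 1) =
      -(2 / (1 + ‖z‖ ^ 2) - 2 / (1 + ‖w‖ ^ 2)) := by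
    field_simp
    ring
  rw [e1, e2, e3, ← hn, neg_sq, ← sq_abs (2 / (1 + ‖z‖ ^ 2) - 2 / (1 + ‖w‖ ^ 2))]
  nlinarith [mul_nonneg (norm_nonneg X) (abs_nonneg (2 / (1 + ‖z‖ ^ 2) - 2 / (1 + ‖w‖ ^ 2)))]

/-- A bound on the spherical derivative gives a Lipschitz bound for the chordal metric. -/
theorem chordalDist_le_of_norm_deriv_le {f : ℂ → ℂ} {s : Set ℂ} {C : ℝ} (hs : Convex ℝ s)
    (hd : ∀ z ∈ s, DifferentiableAt ℂ f z) (hC : ∀ z ∈ s, ‖deriv f z‖ ≤ C * (1 + ‖f z‖ ^ 2))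
    {z w : ℂ} (hz : z ∈ s) (hw : w ∈ s) :
    chordalDist (f z) (f w) ≤ 8 * C * ‖z - w‖ := by
  set v := z - w with hv
  have hmem : ∀ t ∈ Set.Icc (0 : ℝ) 1, w + t * v ∈ s := fun t ht => by
    simpa using hs.add_smul_sub_mem hw hz ht
  set γ : ℝ → ℂ := fun t => f (w + t * v)
  set γ' : ℝ → ℂ := fun t => deriv f (w + t * v) * v
  have hγ : ∀ t ∈ Set.Icc (0 : ℝ) 1, HasDerivAt γ (γ' t) t := fun t ht =>
    HasDerivAt.comp (𝕜 := ℝ) (𝕜' := ℂ) t (hd _ (hmem t ht)).hasDerivAt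
      (by simpa using ((Complex.ofRealCLM.hasDerivAt (x := t)).mul_const v).const_add w)
  have hγ' : ∀ t ∈ Set.Icc (0 : ℝ) 1, ‖γ' t‖ ≤ C * ‖v‖ * (1 + ‖γ t‖ ^ 2) := fun t ht => by
    calc ‖γ' t‖ = ‖deriv f (w + t * v)‖ * ‖v‖ := norm_mul _ _
      _ ≤ C * (1 + ‖γ t‖ ^ 2) * ‖v‖ := by gcongr; exact hC _ (hmem t ht)
      _ = _ := by ring
  have hN : ∀ t, 0 < 1 + ‖γ t‖ ^ 2 := fun t => by positivity
  set A : ℝ → ℝ := fun t => 2 / (1 + ‖γ t‖ ^ 2)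
  set A' : ℝ → ℝ := fun t => (0 * (1 + ‖γ t‖ ^ 2) - 2 * (2 * inner ℝ (γ t) (γ' t))) /
    (1 + ‖γ t‖ ^ 2) ^ 2
  have hA : ∀ t ∈ Set.Icc (0 : ℝ) 1, HasDerivAt A (A' t) t := fun t ht =>
    (hasDerivAt_const t (2 : ℝ)).div ((hγ t ht).norm_sq.const_add 1) (hN t).ne'
  have hA' : ∀ t ∈ Set.Icc (0 : ℝ) 1, |A' t| * (1 + ‖γ t‖ ^ 2) ≤ 4 * ‖γ t‖ * (C * ‖v‖) :=
    fun t ht => by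
      have e : |A' t| * (1 + ‖γ t‖ ^ 2) = 4 * |inner ℝ (γ t) (γ' t)| / (1 + ‖γ t‖ ^ 2) := by
        have : A' t = -(4 * inner ℝ (γ t) (γ' t) / (1 + ‖γ t‖ ^ 2) ^ 2) := by
          simp only [A']; ring
        rw [this, abs_neg, abs_div, abs_mul, abs_of_pos (pow_pos (hN t) 2),
          abs_of_pos (show (0 : ℝ) < 4 by norm_num)]
        have := (hN t).ne'
        field_simp
      rw [e, div_le_iff₀ (hN t)]
      calc 4 * |inner ℝ (γ t) (γ' t)| ≤ 4 * (‖γ t‖ * ‖γ' t‖) := by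
            gcongr; exact abs_real_inner_le_norm _ _
        _ ≤ 4 * (‖γ t‖ * (C * ‖v‖ * (1 + ‖γ t‖ ^ 2))) := by gcongr; exact hγ' t ht
        _ = _ := by ring
  have hCv : 0 ≤ C * ‖v‖ := by
    have := (norm_nonneg _).trans (hγ' 0 (by simp))
    exact nonneg_of_mul_nonneg_left this (hN 0)
  have bA : ∀ t ∈ Set.Icc (0 : ℝ) 1, ‖A' t‖ ≤ 2 * (C * ‖v‖) := fun t ht => by
    refine le_of_mul_le_mul_right ((hA' t ht).trans ?_) (hN t)
    nlinarith [mul_nonneg hCv (sq_nonneg (‖γ t‖ - 1))]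
  have bX : ∀ t ∈ Set.Icc (0 : ℝ) 1, ‖A t • γ' t + A' t • γ t‖ ≤ 6 * (C * ‖v‖) := fun t ht => by
    have i1 : ‖A t • γ' t‖ ≤ 2 * (C * ‖v‖) := by
      rw [norm_smul, Real.norm_of_nonneg (div_pos two_pos (hN t)).le, div_mul_eq_mul_div,
        div_le_iff₀ (hN t)]
      linarith [hγ' t ht]
    have i2 : ‖A' t • γ t‖ ≤ 4 * (C * ‖v‖) := by
      rw [norm_smul, Real.norm_eq_abs]
      refine le_of_mul_le_mul_right ?_ (hN t)
      calc |A' t| * ‖γ t‖ * (1 + ‖γ t‖ ^ 2) = |A' t| * (1 + ‖γ t‖ ^ 2) * ‖γ t‖ := by ring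
        _ ≤ 4 * ‖γ t‖ * (C * ‖v‖) * ‖γ t‖ :=
            mul_le_mul_of_nonneg_right (hA' t ht) (norm_nonneg _)
        _ ≤ 4 * (C * ‖v‖) * (1 + ‖γ t‖ ^ 2) := by linarith
    linarith [norm_add_le (A t • γ' t) (A' t • γ t)]
  -- The mean value inequality for the planar part and for the height gives constants 6 and 2,
  -- whence the 8.
  have m1 : ‖A 1 • γ 1 - A 0 • γ 0‖ ≤ 6 * (C * ‖v‖) * ‖(1 : ℝ) - 0‖ :=
    (convex_Icc (0 : ℝ) 1).norm_image_sub_le_of_norm_hasDerivWithin_le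
      (f := fun t => A t • γ t) (f' := fun t => A t • γ' t + A' t • γ t)
      (fun t ht => ((hA t ht).smul (hγ t ht)).hasDerivWithinAt) bX (by simp) (by simp)
  have m2 : ‖A 1 - A 0‖ ≤ 2 * (C * ‖v‖) * ‖(1 : ℝ) - 0‖ :=
    (convex_Icc (0 : ℝ) 1).norm_image_sub_le_of_norm_hasDerivWithin_le
      (fun t ht => (hA t ht).hasDerivWithinAt) bA (by simp) (by simp)
  have g1 : γ 1 = f z := by simp [γ, hv]
  have g0 : γ 0 = f w := by simp [γ]
  have := chordalDist_coe_le (γ 1) (γ 0)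
  rw [← g1, ← g0]
  rw [sub_zero, norm_one, mul_one] at m1 m2
  rw [Real.norm_eq_abs] at m2
  simp only [A] at m1 m2
  linarith

theorem dist_stereo_coe_infty (z : ℂ) :
    dist (stereo z) (stereo ∞) = √(4 / (‖z‖ ^ 2 + 1)) := by
  rw [EuclideanSpace.dist_eq, Fin.sum_univ_three]
  simp only [stereo, Real.dist_eq, sq_abs, Matrix.cons_val_zero, Matrix.cons_val_one,
    Matrix.cons_val]
  congr 1
  have h : ‖z‖ ^ 2 + 1 ≠ 0 := by positivity
  have hn : ‖z‖ ^ 2 = z.re ^ 2 + z.im ^ 2 := by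
    rw [Complex.sq_norm, Complex.normSq_apply]; ring
  field_simp
  rw [hn]
  ring

theorem continuous_stereo : Continuous stereo := by
  refine continuous_iff_continuousAt.2 fun p => ?_
  induction p using OnePoint.rec with
  | infty =>
    rw [OnePoint.continuousAt_infty', tendsto_iff_dist_tendsto_zero]
    simp only [Function.comp_apply, dist_stereo_coe_infty]
    have h1 : Tendsto (fun z : ℂ => ‖z‖ ^ 2 + 1) (coclosedCompact ℂ) atTop := by
      rw [coclosedCompact_eq_cocompact]
      exact tendsto_atTop_add_const_right _ _
        ((tendsto_pow_atTop two_ne_zero).comp (tendsto_norm_cocompact_atTop))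
    simpa using (h1.const_div_atTop 4).sqrt
  | coe z =>
    rw [OnePoint.continuousAt_coe]
    refine (PiLp.continuous_toLp 2 _).continuousAt.comp (continuousAt_pi.2 fun i => ?_)
    have h : ‖z‖ ^ 2 + 1 ≠ 0 := by positivity
    fin_cases i
    · exact ContinuousAt.div (f := fun z : ℂ => 2 * z.re) (g := fun z : ℂ => ‖z‖ ^ 2 + 1)
        (by fun_prop) (by fun_prop) h
    · exact ContinuousAt.div (f := fun z : ℂ => 2 * z.im) (g := fun z : ℂ => ‖z‖ ^ 2 + 1)
        (by fun_prop) (by fun_prop) h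
    · exact ContinuousAt.div (f := fun z : ℂ => ‖z‖ ^ 2 - 1) (g := fun z : ℂ => ‖z‖ ^ 2 + 1)
        (by fun_prop) (by fun_prop) h

theorem injective_stereo : Function.Injective stereo := by
  have hinf : ∀ z : ℂ, stereo z ≠ stereo ∞ := fun z h => by
    have := dist_stereo_coe_infty z
    rw [h, dist_self] at this
    have h2 : 0 < √(4 / (‖z‖ ^ 2 + 1)) := by positivity
    exact h2.ne this
  intro p q h
  induction p using OnePoint.rec with
  | infty =>
    induction q using OnePoint.rec with
    | infty => rfl
    | coe w => exact absurd h.symm (hinf w)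
  | coe z =>
    induction q using OnePoint.rec with
    | infty => exact absurd h (hinf z)
    | coe w =>
      have h0 := congrArg (fun v : EuclideanSpace ℝ (Fin 3) => v 0) h
      have h1 := congrArg (fun v : EuclideanSpace ℝ (Fin 3) => v 1) h
      have h2 := congrArg (fun v : EuclideanSpace ℝ (Fin 3) => v 2) h
      simp only [stereo, Matrix.cons_val_zero, Matrix.cons_val_one, Matrix.cons_val] at h0 h1 h2
      have hz : 0 < ‖z‖ ^ 2 + 1 := by positivity
      have hw : 0 < ‖w‖ ^ 2 + 1 := by positivity
      have hN : ‖z‖ ^ 2 + 1 = ‖w‖ ^ 2 + 1 := by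
        rw [div_eq_div_iff hz.ne' hw.ne'] at h2
        linarith
      rw [hN, div_left_inj' hw.ne'] at h0 h1
      congr 1
      exact Complex.ext (by linarith) (by linarith)

theorem isEmbedding_stereo : Topology.IsEmbedding stereo :=
  (continuous_stereo.isClosedEmbedding injective_stereo).isEmbedding

/-- The Riemann sphere as a metric space, with the chordal metric. -/
@[reducible] noncomputable def chordalMetricSpace : MetricSpace RiemannSphere :=
  -- This structure keeps the one-point compactification topology, and its distance unfolds to
  -- `chordalDist`.
  isEmbedding_stereo.comapMetricSpace stereo

attribute [local instance] chordalMetricSpace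

/-! ### Montel's theorem for the values 0, 1, ∞. -/

theorem equicontinuousAt_of_omits {ι : Type*} {g : ι → ℂ → ℂ} {t₀ : ℂ} {R : ℝ} (hR : 0 < R)
    (hg : ∀ i, DifferentiableOn ℂ (g i) (Metric.ball t₀ R))
    (h0 : ∀ i, ∀ t ∈ Metric.ball t₀ R, g i t ≠ 0) (h1 : ∀ i, ∀ t ∈ Metric.ball t₀ R, g i t ≠ 1) :
    EquicontinuousAt (fun i t => (g i t : RiemannSphere)) t₀ := by
  obtain ⟨C, hC0, hC⟩ := exists_norm_deriv_le hR
  have hmap : Set.MapsTo (fun z => t₀ + z) (Metric.ball (0 : ℂ) R) (Metric.ball t₀ R) := by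
    intro z hz
    simpa using hz
  have hlip : ∀ i, ∀ z ∈ Metric.ball (0 : ℂ) (R / 4),
      dist (g i t₀ : RiemannSphere) (g i (t₀ + z)) ≤ 8 * C * ‖z‖ := fun i z hz => by
    have hd : DifferentiableOn ℂ (fun z => g i (t₀ + z)) (Metric.ball 0 R) :=
      (hg i).comp (by fun_prop) hmap
    have key := chordalDist_le_of_norm_deriv_le (convex_ball (0 : ℂ) (R / 4))
      (fun z hz => hd.differentiableAt (Metric.isOpen_ball.mem_nhds
        (Metric.ball_subset_ball (by linarith) hz)))
      (hC _ hd (fun z hz => h0 i _ (hmap hz)) fun z hz => h1 i _ (hmap hz))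
      (Metric.mem_ball_self (by linarith)) hz
    simp only [add_zero, zero_sub, norm_neg] at key
    exact key
  rw [Metric.equicontinuousAt_iff]
  intro ε hε
  refine ⟨min (R / 4) (ε / (8 * C + 1)), by positivity, fun t ht i => ?_⟩
  rw [dist_eq_norm, lt_min_iff] at ht
  have := hlip i (t - t₀) (by simpa using ht.1)
  rw [add_sub_cancel] at this
  refine this.trans_lt ?_
  have h2 := (lt_div_iff₀ (by positivity)).1 ht.2
  linarith [norm_nonneg (t - t₀)]

/-! ### Homogeneous coordinates and charts. -/

/-- The point of the sphere with homogeneous coordinates `v`. -/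
noncomputable def proj (v : ℂ × ℂ) : RiemannSphere :=
  if v.2 = 0 then ∞ else ((v.1 / v.2 : ℂ) : RiemannSphere)

/-- The determinant of two vectors of the plane. -/
def cross (v w : ℂ × ℂ) : ℂ := v.1 * w.2 - v.2 * w.1

theorem proj_of_snd_eq_zero {v : ℂ × ℂ} (h : v.2 = 0) : proj v = ∞ := if_pos h

theorem proj_of_snd_ne_zero {v : ℂ × ℂ} (h : v.2 ≠ 0) : proj v = ((v.1 / v.2 : ℂ) : RiemannSphere) :=
  if_neg h

theorem proj_eq_iff {v w : ℂ × ℂ} (hv : v ≠ 0) (hw : w ≠ 0) :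
    proj v = proj w ↔ cross v w = 0 := by
  obtain ⟨a, b⟩ := v
  obtain ⟨c, d⟩ := w
  unfold cross proj
  by_cases hb : b = 0 <;> by_cases hd : d = 0
  · simp [hb, hd]
  · have : a ≠ 0 := by rintro rfl; exact hv (by simp [hb])
    simp [hb, hd, this]
  · have : c ≠ 0 := by rintro rfl; exact hw (by simp [hd])
    simp [hb, hd, this]
  · simp only [hb, hd, if_false, OnePoint.coe_eq_coe]
    rw [div_eq_div_iff hb hd, sub_eq_zero, mul_comm c b]

theorem proj_smul {c : ℂ} (hc : c ≠ 0) (v : ℂ × ℂ) : proj (c • v) = proj v := by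
  unfold proj
  by_cases h : v.2 = 0 <;> simp [h, hc, mul_div_mul_left]

theorem exists_smul_of_proj_eq {v w : ℂ × ℂ} (hv : v ≠ 0) (hw : w ≠ 0) (h : proj v = proj w) :
    ∃ c : ℂ, c ≠ 0 ∧ v = c • w := by
  rw [proj_eq_iff hv hw] at h
  obtain ⟨a, b⟩ := v
  obtain ⟨c, d⟩ := w
  simp only [cross] at h
  by_cases hc : c = 0
  · subst hc
    have hd : d ≠ 0 := by rintro rfl; exact hw rfl
    have ha : a = 0 := by simpa [hd] using h
    subst ha
    have hb : b ≠ 0 := by rintro rfl; exact hv rfl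
    exact ⟨b / d, div_ne_zero hb hd, by simp [hd]⟩
  · have ha : a ≠ 0 := by
      rintro rfl
      have hb : b = 0 := by simpa [hc] using h
      exact hv (by simp [hb])
    refine ⟨a / c, div_ne_zero ha hc, ?_⟩
    ext
    · simp [hc]
    · simp only [Prod.smul_snd, smul_eq_mul]
      field_simp
      linear_combination -h

theorem continuousAt_proj {v : ℂ × ℂ} (hv : v ≠ 0) : ContinuousAt proj v := by
  by_cases h : v.2 = 0
  · have h1 : v.1 ≠ 0 := fun e => hv (Prod.ext e h)
    have hne : ‖v.1‖ ^ 2 + ‖v.2‖ ^ 2 ≠ 0 := by positivity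
    rw [ContinuousAt, proj_of_snd_eq_zero h, tendsto_iff_dist_tendsto_zero]
    have hev : (fun w : ℂ × ℂ => √(4 * ‖w.2‖ ^ 2 / (‖w.1‖ ^ 2 + ‖w.2‖ ^ 2))) =ᶠ[𝓝 v]
        fun w => dist (proj w) ∞ := by
      filter_upwards with w
      by_cases hw : w.2 = 0
      · simp [hw, proj_of_snd_eq_zero]
      · rw [proj_of_snd_ne_zero hw]
        refine Eq.trans ?_ (dist_stereo_coe_infty _).symm
        rw [norm_div]
        have : ‖w.2‖ ≠ 0 := by simpa using hw
        congr 1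
        field_simp
    refine Tendsto.congr' hev ?_
    have : ContinuousAt (fun w : ℂ × ℂ => √(4 * ‖w.2‖ ^ 2 / (‖w.1‖ ^ 2 + ‖w.2‖ ^ 2))) v :=
      (ContinuousAt.div (f := fun w : ℂ × ℂ => 4 * ‖w.2‖ ^ 2)
        (g := fun w : ℂ × ℂ => ‖w.1‖ ^ 2 + ‖w.2‖ ^ 2) (by fun_prop) (by fun_prop) hne).sqrt
    simpa [ContinuousAt, h] using this
  · have hev : (fun w : ℂ × ℂ => ((w.1 / w.2 : ℂ) : RiemannSphere)) =ᶠ[𝓝 v] proj := by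
      have : ContinuousAt (fun w : ℂ × ℂ => w.2) v := by fun_prop
      filter_upwards [this.eventually_ne h] with w hw
      exact (proj_of_snd_ne_zero hw).symm
    refine ContinuousAt.congr ?_ hev
    exact OnePoint.continuous_coe.continuousAt.comp
      (ContinuousAt.div (f := fun w : ℂ × ℂ => w.1) (g := fun w : ℂ × ℂ => w.2)
        (by fun_prop) (by fun_prop) h)

/-- Homogeneous coordinates of a chart of the sphere centred at a point. -/
noncomputable def chartLift : RiemannSphere → ℂ → ℂ × ℂ
  | ∞ => fun t => (1, t)
  | (z : ℂ) => fun t => (z + t, 1)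

theorem chartLift_ne_zero (p : RiemannSphere) (t : ℂ) : chartLift p t ≠ 0 := by
  induction p using OnePoint.rec <;> simp [chartLift, Prod.ext_iff]

theorem differentiable_chartLift (p : RiemannSphere) : Differentiable ℂ (chartLift p) := by
  induction p using OnePoint.rec with
  | infty => exact (differentiable_const _).prodMk differentiable_id
  | coe z => exact (differentiable_id.const_add z).prodMk (differentiable_const _)

theorem proj_chartLift_zero (p : RiemannSphere) : proj (chartLift p 0) = p := by
  induction p using OnePoint.rec <;> simp [chartLift, proj]

/-- The chart is a local homeomorphism at `p`, so limits at `p` may be computed in the parameter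
`t`. -/
theorem map_proj_chartLift (p : RiemannSphere) :
    map (fun t => proj (chartLift p t)) (𝓝 0) = 𝓝 p := by
  refine le_antisymm ?_ ?_
  · have : ContinuousAt (fun t => proj (chartLift p t)) 0 :=
      (continuousAt_proj (chartLift_ne_zero p 0)).comp
        (differentiable_chartLift p).continuous.continuousAt
    simpa [ContinuousAt, Tendsto, proj_chartLift_zero] using this
  · induction p using OnePoint.rec with
    | infty =>
      set σ : RiemannSphere → ℂ := fun q => q.elim 0 fun z => z⁻¹
      have hσ : ContinuousAt σ ∞ := by
        rw [OnePoint.continuousAt_infty', coclosedCompact_eq_cocompact]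
        exact tendsto_inv₀_cobounded.comp (Metric.cobounded_eq_cocompact (α := ℂ)).ge
      have hid : (fun q => proj (chartLift ∞ (σ q))) =ᶠ[𝓝 ∞] id := by
        have hne : ∀ᶠ q in 𝓝 (∞ : RiemannSphere), q ≠ ((0 : ℂ) : RiemannSphere) :=
          isOpen_ne.mem_nhds (OnePoint.infty_ne_coe 0)
        filter_upwards [hne] with q hq
        induction q using OnePoint.rec with
        | infty => simp [σ, chartLift, proj]
        | coe z =>
          have hz : z ≠ 0 := fun e => hq (by rw [e])
          simp [σ, chartLift, proj, hz]
      have h0 : Tendsto σ (𝓝 ∞) (𝓝 0) := hσ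
      calc 𝓝 (∞ : RiemannSphere) = map (fun q => proj (chartLift ∞ (σ q))) (𝓝 ∞) := by
            rw [map_congr hid, Filter.map_id]
        _ = map (fun t => proj (chartLift ∞ t)) (map σ (𝓝 ∞)) := by rw [map_map]; rfl
        _ ≤ _ := map_mono h0
    | coe z =>
      have : (fun t => proj (chartLift z t)) = (fun w : ℂ => (w : RiemannSphere)) ∘ fun t => z + t := by
        ext t
        simp [chartLift, proj]
      rw [this, ← map_map, map_add_left_nhds, add_zero, OnePoint.nhds_coe_eq]

/-! ### Cross ratios and Montel's theorem for moving targets. -/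

/-- The vector whose cross ratio with `u`, `v`, `w` is `[s.1 : s.2]`. -/
def crossRatioInv (u v w s : ℂ × ℂ) : ℂ × ℂ :=
  (s.2 * cross w v) • u - (s.1 * cross w u) • v

theorem crossRatioInv_ne_zero {u v w s : ℂ × ℂ} (huv : cross u v ≠ 0) (hwu : cross w u ≠ 0)
    (hwv : cross w v ≠ 0) (hs : s ≠ 0) : crossRatioInv u v w s ≠ 0 := by
  intro h
  have e1 : cross (crossRatioInv u v w s) u = s.1 * cross w u * cross u v := by
    simp only [crossRatioInv, cross, Prod.fst_sub, Prod.snd_sub, Prod.smul_fst, Prod.smul_snd,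
      smul_eq_mul]
    ring
  have e2 : cross (crossRatioInv u v w s) v = s.2 * cross w v * cross u v := by
    simp only [crossRatioInv, cross, Prod.fst_sub, Prod.snd_sub, Prod.smul_fst, Prod.smul_snd,
      smul_eq_mul]
    ring
  rw [h] at e1 e2
  simp only [cross, Prod.fst_zero, Prod.snd_zero, zero_mul, sub_self] at e1 e2 huv hwu hwv
  refine hs (Prod.ext ?_ ?_)
  · simpa [huv, hwu] using e1.symm
  · simpa [huv, hwv] using e2.symm

/-- Joint continuity is needed because the targets move. As `crossRatioInv` is linear in its last
argument, the choice of representative `chartLift q.2 0` is immaterial and continuity can be tested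
in the chart at `p`. -/
theorem continuousAt_crossRatioInv {u v w : ℂ → ℂ × ℂ} {t : ℂ} (hu : ContinuousAt u t)
    (hv : ContinuousAt v t) (hw : ContinuousAt w t) (huv : cross (u t) (v t) ≠ 0)
    (hwu : cross (w t) (u t) ≠ 0) (hwv : cross (w t) (v t) ≠ 0) (p : RiemannSphere) :
    ContinuousAt (fun q : ℂ × RiemannSphere =>
      proj (crossRatioInv (u q.1) (v q.1) (w q.1) (chartLift q.2 0))) (t, p) := by
  have hbar : Tendsto (fun q : ℂ × ℂ => proj (crossRatioInv (u q.1) (v q.1) (w q.1)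
      (chartLift p q.2))) (𝓝 (t, 0))
      (𝓝 (proj (crossRatioInv (u t) (v t) (w t) (chartLift p 0)))) := by
    have hc : ContinuousAt (fun q : ℂ × ℂ => crossRatioInv (u q.1) (v q.1) (w q.1)
        (chartLift p q.2)) (t, 0) := by
      have hu' : ContinuousAt (fun q : ℂ × ℂ => u q.1) (t, 0) := hu.comp (x := (t, 0)) continuousAt_fst
      have hv' : ContinuousAt (fun q : ℂ × ℂ => v q.1) (t, 0) := hv.comp (x := (t, 0)) continuousAt_fst
      have hw' : ContinuousAt (fun q : ℂ × ℂ => w q.1) (t, 0) := hw.comp (x := (t, 0)) continuousAt_fst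
      have hp' : ContinuousAt (fun q : ℂ × ℂ => chartLift p q.2) (t, 0) :=
        (differentiable_chartLift p).continuous.continuousAt.comp (x := (t, 0)) continuousAt_snd
      unfold crossRatioInv cross
      fun_prop
    exact ContinuousAt.comp (f := fun q : ℂ × ℂ => crossRatioInv (u q.1) (v q.1) (w q.1)
        (chartLift p q.2)) (x := (t, 0)) (g := proj) (continuousAt_proj
      (crossRatioInv_ne_zero huv hwu hwv (chartLift_ne_zero p 0))) hc
  have hlin : ∀ (t : ℂ) (s : ℂ), proj (crossRatioInv (u t) (v t) (w t)
      (chartLift (proj (chartLift p s)) 0)) =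
        proj (crossRatioInv (u t) (v t) (w t) (chartLift p s)) := fun t s => by
    obtain ⟨c, hc, h⟩ := exists_smul_of_proj_eq (chartLift_ne_zero (proj (chartLift p s)) 0)
      (chartLift_ne_zero p s) (proj_chartLift_zero _)
    rw [h, ← proj_smul hc (crossRatioInv (u t) (v t) (w t) (chartLift p s))]
    congr 1
    simp only [crossRatioInv, smul_sub, smul_smul, Prod.smul_fst, Prod.smul_snd, smul_eq_mul,
      mul_assoc]
  rw [ContinuousAt, nhds_prod_eq, ← map_proj_chartLift p, ← Filter.map_id (f := 𝓝 t), prod_map_map_eq,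
    tendsto_map'_iff, ← nhds_prod_eq]
  exact hbar.congr fun q => (hlin q.1 q.2).symm

/-- Montel's theorem for moving targets: a family of holomorphic maps to the sphere omitting three
pairwise distinct holomorphic functions is equicontinuous. -/
theorem equicontinuousAt_proj {ι : Type*} {X : ι → ℂ → ℂ × ℂ} {u v w : ℂ → ℂ × ℂ} {t₀ : ℂ} {R : ℝ}
    (hR : 0 < R) (hX : ∀ i, Differentiable ℂ (X i)) (hu : Differentiable ℂ u)
    (hv : Differentiable ℂ v) (hw : Differentiable ℂ w)
    (huv : ∀ t ∈ Metric.ball t₀ R, cross (u t) (v t) ≠ 0)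
    (hwu : ∀ t ∈ Metric.ball t₀ R, cross (w t) (u t) ≠ 0)
    (hwv : ∀ t ∈ Metric.ball t₀ R, cross (w t) (v t) ≠ 0)
    (hXu : ∀ i, ∀ t ∈ Metric.ball t₀ R, cross (X i t) (u t) ≠ 0)
    (hXv : ∀ i, ∀ t ∈ Metric.ball t₀ R, cross (X i t) (v t) ≠ 0)
    (hXw : ∀ i, ∀ t ∈ Metric.ball t₀ R, cross (X i t) (w t) ≠ 0) :
    EquicontinuousAt (fun i t => proj (X i t)) t₀ := by
  have hcross : ∀ {a b : ℂ → ℂ × ℂ}, Differentiable ℂ a → Differentiable ℂ b →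
      Differentiable ℂ fun t => cross (a t) (b t) := fun ha hb =>
    (ha.fst.mul hb.snd).sub (ha.snd.mul hb.fst)
  set g : ι → ℂ → ℂ := fun i t =>
    cross (X i t) (u t) * cross (w t) (v t) / (cross (X i t) (v t) * cross (w t) (u t)) with hgdef
  have hg : EquicontinuousAt (fun i t => (g i t : RiemannSphere)) t₀ := by
    refine equicontinuousAt_of_omits hR (fun i => ?_) (fun i t ht => ?_) (fun i t ht h => ?_)
    · exact (((hcross (hX i) hu).mul (hcross hw hv)).differentiableOn).div
        (((hcross (hX i) hv).mul (hcross hw hu)).differentiableOn)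
        fun t ht => mul_ne_zero (hXv i t ht) (hwu t ht)
    · exact div_ne_zero (mul_ne_zero (hXu i t ht) (hwv t ht)) (mul_ne_zero (hXv i t ht) (hwu t ht))
    -- Plücker relation: numerator minus denominator of `g i t` is cross(X, w) · cross(u, v), so the
    -- value 1 means X = w.
    · rw [hgdef] at h
      simp only [] at h
      rw [div_eq_one_iff_eq (mul_ne_zero (hXv i t ht) (hwu t ht)), ← sub_eq_zero] at h
      refine mul_ne_zero (hXw i t ht) (huv t ht) ?_
      rw [← h]
      simp only [cross]
      ring
  set Ψ : ℂ → RiemannSphere → RiemannSphere := fun t p =>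
    proj (crossRatioInv (u t) (v t) (w t) (chartLift p 0)) with hΨ
  have hΨg : ∀ i, ∀ t ∈ Metric.ball t₀ R, proj (X i t) = Ψ t (g i t) := fun i t ht => by
    have hne : X i t ≠ 0 := fun e => hXu i t ht (by rw [e]; simp [cross])
    rw [hΨ]
    simp only []
    rw [proj_eq_iff hne (crossRatioInv_ne_zero (huv t ht) (hwu t ht) (hwv t ht)
      (chartLift_ne_zero _ _))]
    have e : cross (X i t) (crossRatioInv (u t) (v t) (w t) (chartLift (g i t) 0)) =
        cross (w t) (v t) * cross (X i t) (u t) -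
          g i t * (cross (X i t) (v t) * cross (w t) (u t)) := by
      simp only [crossRatioInv, chartLift, cross, Prod.fst_sub, Prod.snd_sub, Prod.smul_fst,
        Prod.smul_snd, smul_eq_mul, add_zero, one_mul]
      ring
    rw [e, hgdef]
    simp only []
    rw [div_mul_cancel₀ _ (mul_ne_zero (hXv i t ht) (hwu t ht))]
    ring
  have hcont : ∀ t ∈ Metric.ball t₀ R, ∀ p, ContinuousAt (Function.uncurry Ψ) (t, p) :=
    fun t ht p => continuousAt_crossRatioInv hu.continuous.continuousAt hv.continuous.continuousAt
      hw.continuous.continuousAt (huv t ht) (hwu t ht) (hwv t ht) p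
  have ht₀ : t₀ ∈ Metric.ball t₀ R := Metric.mem_ball_self hR
  rw [Metric.equicontinuousAt_iff] at hg ⊢
  intro ε hε
  -- Compactness of the sphere is used twice: `Ψ t₀` is uniformly continuous, and `Ψ t` is uniformly
  -- close to `Ψ t₀` for t near t₀.
  have huc : UniformContinuous (Ψ t₀) := by
    refine CompactSpace.uniformContinuous_of_continuous (continuous_iff_continuousAt.2 fun p => ?_)
    exact (hcont t₀ ht₀ p).comp (f := fun p => (t₀, p)) (by fun_prop)
  obtain ⟨η, hη, hηε⟩ := Metric.uniformContinuous_iff.1 huc (ε / 2) (by linarith)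
  obtain ⟨V, hV, hVε⟩ := IsCompact.mem_uniformity_of_prod (f := Ψ) (s := Metric.ball t₀ R)
    (k := Set.univ) (q := t₀) isCompact_univ
    (fun q hq => (hcont q.1 hq.1 q.2).continuousWithinAt) ht₀
    (Metric.dist_mem_uniformity (half_pos hε))
  rw [Metric.isOpen_ball.nhdsWithin_eq ht₀] at hV
  obtain ⟨δ₁, hδ₁, hδV⟩ := Metric.mem_nhds_iff.1 hV
  obtain ⟨δ₂, hδ₂, hδg⟩ := hg η hη
  refine ⟨min R (min δ₁ δ₂), by positivity, fun t ht i => ?_⟩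
  simp only [lt_min_iff] at ht
  rw [hΨg i t ht.1, hΨg i t₀ ht₀]
  have a1 : dist (Ψ t (g i t)) (Ψ t₀ (g i t)) < ε / 2 := hVε t (hδV ht.2.1) _ trivial
  have a2 := hηε (hδg t ht.2.2 i)
  rw [dist_comm] at a1
  linarith [dist_triangle (Ψ t₀ (g i t₀)) (Ψ t₀ (g i t)) (Ψ t (g i t))]

/-! ### Rational maps in homogeneous coordinates. -/

/-- The homogenization of degree `d` of a polynomial in one variable. -/
noncomputable def homEval (d : ℕ) (p : Polynomial ℂ) (v : ℂ × ℂ) : ℂ :=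
  ∑ i ∈ Finset.range (d + 1), p.coeff i * (v.1 ^ i * v.2 ^ (d - i))

theorem homEval_of_snd_ne_zero {d : ℕ} {p : Polynomial ℂ} (hp : p.natDegree ≤ d) {v : ℂ × ℂ}
    (hv : v.2 ≠ 0) : homEval d p v = v.2 ^ d * p.eval (v.1 / v.2) := by
  rw [Polynomial.eval_eq_sum_range' (Nat.lt_succ_of_le hp), Finset.mul_sum, homEval]
  refine Finset.sum_congr rfl fun i hi => ?_
  have hi' : i ≤ d := Nat.lt_succ_iff.1 (Finset.mem_range.1 hi)
  rw [← Nat.sub_add_cancel hi', Nat.add_sub_cancel, pow_add, div_pow]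
  field_simp

theorem homEval_of_snd_eq_zero (d : ℕ) (p : Polynomial ℂ) {v : ℂ × ℂ} (hv : v.2 = 0) :
    homEval d p v = p.coeff d * v.1 ^ d := by
  rw [homEval, Finset.sum_range_succ, Finset.sum_eq_zero]
  · simp
  · intro i hi
    rw [hv, zero_pow (Nat.sub_ne_zero_of_lt (Finset.mem_range.1 hi))]
    simp

theorem differentiable_homEval (d : ℕ) (p : Polynomial ℂ) : Differentiable ℂ (homEval d p) := by
  unfold homEval
  fun_prop

/-- The action of a rational map on homogeneous coordinates. -/
noncomputable def homLift (R : RatFunc ℂ) (v : ℂ × ℂ) : ℂ × ℂ :=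
  (homEval (mapDegree R) R.num v, homEval (mapDegree R) R.denom v)

theorem differentiable_homLift (R : RatFunc ℂ) : Differentiable ℂ (homLift R) :=
  (differentiable_homEval _ _).prodMk (differentiable_homEval _ _)

theorem num_natDegree_le (R : RatFunc ℂ) : R.num.natDegree ≤ mapDegree R := le_max_left _ _

theorem denom_natDegree_le (R : RatFunc ℂ) : R.denom.natDegree ≤ mapDegree R := le_max_right _ _

theorem sphereMap_infty (R : RatFunc ℂ) : sphereMap R ∞ =
    if R.denom.natDegree < R.num.natDegree then ∞
      else ((R.num.coeff R.denom.natDegree / R.denom.leadingCoeff : ℂ) : RiemannSphere) := rfl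

theorem sphereMap_coe (R : RatFunc ℂ) (z : ℂ) : sphereMap R z =
    if R.denom.eval z = 0 then ∞
      else ((R.num.eval z / R.denom.eval z : ℂ) : RiemannSphere) := rfl

/-- A common zero contradicts coprimality at a finite point; at infinity the two values are the
coefficients of degree `mapDegree R` times a nonzero power, and one of these is a leading
coefficient. -/
theorem homLift_ne_zero (R : RatFunc ℂ) {v : ℂ × ℂ} (hv : v ≠ 0) : homLift R v ≠ 0 := by
  intro h
  have hn : homEval (mapDegree R) R.num v = 0 := congrArg Prod.fst h
  have hd : homEval (mapDegree R) R.denom v = 0 := congrArg Prod.snd h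
  by_cases h2 : v.2 = 0
  · have h1 : v.1 ≠ 0 := fun e => hv (Prod.ext e h2)
    rw [homEval_of_snd_eq_zero _ _ h2, mul_eq_zero_iff_right (pow_ne_zero _ h1)] at hn hd
    rcases le_or_gt R.num.natDegree R.denom.natDegree with hle | hlt
    · rw [mapDegree, max_eq_right hle] at hd
      exact R.denom_ne_zero (Polynomial.leadingCoeff_eq_zero.1 hd)
    · rw [mapDegree, max_eq_left hlt.le] at hn
      rw [Polynomial.leadingCoeff_eq_zero.1 hn, Polynomial.natDegree_zero] at hlt
      exact absurd hlt (Nat.not_lt_zero _)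
  · rw [homEval_of_snd_ne_zero (num_natDegree_le R) h2,
      mul_eq_zero_iff_left (pow_ne_zero _ h2)] at hn
    rw [homEval_of_snd_ne_zero (denom_natDegree_le R) h2,
      mul_eq_zero_iff_left (pow_ne_zero _ h2)] at hd
    obtain ⟨a, b, hab⟩ := R.isCoprime_num_denom
    have := congrArg (Polynomial.eval (v.1 / v.2)) hab
    simp [hn, hd] at this

theorem proj_homLift (R : RatFunc ℂ) {v : ℂ × ℂ} (hv : v ≠ 0) :
    proj (homLift R v) = sphereMap R (proj v) := by
  by_cases h2 : v.2 = 0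
  · have h1 : v.1 ≠ 0 := fun e => hv (Prod.ext e h2)
    have hp : v.1 ^ mapDegree R ≠ 0 := pow_ne_zero _ h1
    rw [proj_of_snd_eq_zero h2, sphereMap_infty, proj, homLift]
    simp only [homEval_of_snd_eq_zero _ _ h2]
    rcases le_or_gt R.num.natDegree R.denom.natDegree with hle | hlt
    · have hm : mapDegree R = R.denom.natDegree := max_eq_right hle
      rw [hm] at hp ⊢
      have hc : R.denom.coeff R.denom.natDegree ≠ 0 :=
        fun h => R.denom_ne_zero (Polynomial.leadingCoeff_eq_zero.1 h)
      rw [if_neg (mul_ne_zero hc hp), if_neg (not_lt.2 hle), mul_div_mul_right _ _ hp]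
      rfl
    · have hm : R.denom.natDegree < mapDegree R := hlt.trans_le (le_max_left _ _)
      rw [Polynomial.coeff_eq_zero_of_natDegree_lt hm, if_pos (zero_mul _), if_pos hlt]
  · have hp : v.2 ^ mapDegree R ≠ 0 := pow_ne_zero _ h2
    rw [proj_of_snd_ne_zero h2, sphereMap_coe, proj, homLift]
    simp only [homEval_of_snd_ne_zero (num_natDegree_le R) h2,
      homEval_of_snd_ne_zero (denom_natDegree_le R) h2]
    by_cases hq : R.denom.eval (v.1 / v.2) = 0
    · simp [hq]
    · rw [if_neg (mul_ne_zero hp hq), if_neg hq, mul_div_mul_left _ _ hp]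

theorem homLift_iterate_ne_zero (R : RatFunc ℂ) (n : ℕ) {v : ℂ × ℂ} (hv : v ≠ 0) :
    (homLift R)^[n] v ≠ 0 := by
  induction n with
  | zero => exact hv
  | succ n ih =>
    rw [Function.iterate_succ_apply']
    exact homLift_ne_zero R ih

theorem proj_homLift_iterate (R : RatFunc ℂ) (n : ℕ) {v : ℂ × ℂ} (hv : v ≠ 0) :
    proj ((homLift R)^[n] v) = (sphereMap R)^[n] (proj v) := by
  induction n with
  | zero => rfl
  | succ n ih =>
    rw [Function.iterate_succ_apply', Function.iterate_succ_apply',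
      proj_homLift R (homLift_iterate_ne_zero R n hv), ih]

theorem differentiable_homLift_iterate (R : RatFunc ℂ) (n : ℕ) :
    Differentiable ℂ (homLift R)^[n] := by
  induction n with
  | zero => exact differentiable_id
  | succ n ih =>
    rw [Function.iterate_succ']
    exact (differentiable_homLift R).comp ih

theorem continuous_sphereMap (R : RatFunc ℂ) : Continuous (sphereMap R) := by
  refine continuous_iff_continuousAt.2 fun p => ?_
  rw [ContinuousAt, ← map_proj_chartLift p, tendsto_map'_iff]
  have hc : ContinuousAt (fun t => proj (homLift R (chartLift p t))) 0 :=
    ContinuousAt.comp (f := fun t => homLift R (chartLift p t))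
      (continuousAt_proj (homLift_ne_zero R (chartLift_ne_zero p 0)))
      ((differentiable_homLift R).comp (differentiable_chartLift p)).continuous.continuousAt
  have e : ∀ t, proj (homLift R (chartLift p t)) = sphereMap R (proj (chartLift p t)) :=
    fun t => proj_homLift R (chartLift_ne_zero p t)
  simp only [e] at hc
  rw [ContinuousAt, proj_chartLift_zero] at hc
  exact hc

/-! ### Openness and surjectivity. -/

/-- The open mapping theorem for a map to the sphere given in homogeneous coordinates. -/
theorem nhds_proj_le_map {v : ℂ → ℂ × ℂ} (hv : Differentiable ℂ v) (h0 : ∀ t, v t ≠ 0)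
    (hconst : ¬ ∀ᶠ t in 𝓝 0, proj (v t) = proj (v 0)) :
    𝓝 (proj (v 0)) ≤ map (fun t => proj (v t)) (𝓝 0) := by
  have h1 : AnalyticAt ℂ (fun t => (v t).1) 0 := hv.fst.analyticAt 0
  have h2 : AnalyticAt ℂ (fun t => (v t).2) 0 := hv.snd.analyticAt 0
  by_cases h : (v 0).2 = 0
  · have hne : (v 0).1 ≠ 0 := fun e => h0 0 (Prod.ext e h)
    have hev : (fun t => proj (v t)) =ᶠ[𝓝 0]
        fun t => proj (chartLift ∞ ((v t).2 / (v t).1)) := by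
      filter_upwards [h1.continuousAt.eventually_ne hne] with t ht
      rw [proj_eq_iff (h0 t) (chartLift_ne_zero _ _)]
      simp only [cross, chartLift]
      field_simp
      ring
    have hz : (v 0).2 / (v 0).1 = 0 := by rw [h, zero_div]
    rcases (h2.div h1 hne).eventually_constant_or_nhds_le_map_nhds with hc | ho
    · refine absurd ?_ hconst
      filter_upwards [hc, hev] with t ht ht'
      simp only [Pi.div_apply] at ht
      rw [ht', ht]
      exact hev.self_of_nhds.symm
    · simp only [Pi.div_apply, hz] at ho
      rw [proj_of_snd_eq_zero h, map_congr hev, ← map_proj_chartLift ∞]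
      exact (map_mono ho).trans (by rw [map_map]; rfl)
  · have hev : (fun t => proj (v t)) =ᶠ[𝓝 0]
        fun t => (((v t).1 / (v t).2 : ℂ) : RiemannSphere) := by
      filter_upwards [h2.continuousAt.eventually_ne h] with t ht
      exact proj_of_snd_ne_zero ht
    rcases (h1.div h2 h).eventually_constant_or_nhds_le_map_nhds with hc | ho
    · refine absurd ?_ hconst
      filter_upwards [hc, hev] with t ht ht'
      simp only [Pi.div_apply] at ht
      rw [ht', ht]
      exact hev.self_of_nhds.symm
    · rw [proj_of_snd_ne_zero h, map_congr hev, OnePoint.nhds_coe_eq]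
      exact (map_mono ho).trans (by rw [map_map]; rfl)

/-- Finite points over k are roots of P - kQ. If this vanished identically, coprimality would make Q
a unit and the degree zero. -/
theorem finite_sphereMap_fiber {R : RatFunc ℂ} (hR : 1 ≤ mapDegree R) (q : RiemannSphere) :
    {p | sphereMap R p = q}.Finite := by
  have key : ∃ s : Polynomial ℂ, s ≠ 0 ∧ ∀ z : ℂ, sphereMap R z = q → s.eval z = 0 := by
    induction q using OnePoint.rec with
    | infty =>
      refine ⟨R.denom, R.denom_ne_zero, fun z hz => ?_⟩
      by_contra hne
      rw [sphereMap_coe, if_neg hne] at hz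
      exact OnePoint.coe_ne_infty _ hz
    | coe k =>
      refine ⟨R.num - Polynomial.C k * R.denom, fun h => ?_, fun z hz => ?_⟩
      · have hn : R.num = Polynomial.C k * R.denom := sub_eq_zero.1 h
        have hu : IsUnit R.denom :=
          R.isCoprime_num_denom.isUnit_of_dvd' (by rw [hn]; exact dvd_mul_left _ _) dvd_rfl
        have hd : R.denom.natDegree = 0 := Polynomial.natDegree_eq_zero_of_isUnit hu
        have hn' : R.num.natDegree ≤ 0 := by
          rw [hn, ← hd]
          exact Polynomial.natDegree_C_mul_le _ _
        simp only [mapDegree, hd] at hR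
        omega
      · by_cases hq : R.denom.eval z = 0
        · rw [sphereMap_coe, if_pos hq] at hz
          exact absurd hz (OnePoint.infty_ne_coe _)
        · rw [sphereMap_coe, if_neg hq, OnePoint.coe_eq_coe, div_eq_iff hq] at hz
          simp [hz]
  obtain ⟨s, hs, hs'⟩ := key
  have hfin : ({z : ℂ | s.IsRoot z}).Finite := Polynomial.finite_setOfPred_isRoot hs
  refine ((hfin.image (fun z : ℂ => (z : RiemannSphere))).insert ∞).subset fun p hp => ?_
  induction p using OnePoint.rec with
  | infty => exact Set.mem_insert _ _
  | coe z => exact Set.mem_insert_of_mem _ ⟨z, hs' z hp, rfl⟩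

theorem nhds_sphereMap_le {R : RatFunc ℂ} (hR : 1 ≤ mapDegree R) (p : RiemannSphere) :
    𝓝 (sphereMap R p) ≤ map (sphereMap R) (𝓝 p) := by
  have e : ∀ t, proj (homLift R (chartLift p t)) = sphereMap R (proj (chartLift p t)) :=
    fun t => proj_homLift R (chartLift_ne_zero p t)
  have := nhds_proj_le_map ((differentiable_homLift R).comp (differentiable_chartLift p))
    (fun t => homLift_ne_zero R (chartLift_ne_zero p t)) (fun hc => by
      simp only [Function.comp_apply, e, proj_chartLift_zero] at hc
      have hc' : {q | sphereMap R q = sphereMap R p} ∈ 𝓝 p := by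
        rw [← map_proj_chartLift p]
        exact hc
      refine infinite_of_mem_nhds p hc' (finite_sphereMap_fiber hR _))
  simp only [Function.comp_apply, e, proj_chartLift_zero] at this
  refine this.trans (le_of_eq ?_)
  rw [← map_proj_chartLift p, map_map]
  rfl

/-- The range is compact and open in a connected space. -/
theorem surjective_sphereMap {R : RatFunc ℂ} (hR : 1 ≤ mapDegree R) :
    Function.Surjective (sphereMap R) := by
  rw [← Set.range_eq_univ]
  exact IsClopen.eq_univ ⟨(isCompact_range (continuous_sphereMap R)).isClosed,
    (IsOpenMap.of_nhds_le (nhds_sphereMap_le hR)).isOpen_range⟩ (Set.range_nonempty _)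

/-! ### Equicontinuity away from periodic points, and normality. -/

/-- The iterates are equicontinuous on every open set that contains no periodic point. -/
theorem equicontinuousAt_iterates {R : RatFunc ℂ} (hR : 1 ≤ mapDegree R) {W : Set RiemannSphere}
    (hW : IsOpen W) (hper : ∀ q ∈ W, q ∉ Function.periodicPts (sphereMap R)) {q : RiemannSphere}
    (hq : q ∈ W) : EquicontinuousAt (fun (n : ℕ) p => (sphereMap R)^[n + 1] p) q := by
  obtain ⟨y₁, rfl⟩ := surjective_sphereMap hR q
  obtain ⟨y, rfl⟩ := surjective_sphereMap hR y₁
  have hu : ∀ t, chartLift y t ≠ 0 := chartLift_ne_zero y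
  have hv : ∀ t, homLift R (chartLift y t) ≠ 0 := fun t => homLift_ne_zero R (hu t)
  have hw : ∀ t, homLift R (homLift R (chartLift y t)) ≠ 0 := fun t => homLift_ne_zero R (hv t)
  have hX : ∀ n t, (homLift R)^[n + 1] (homLift R (homLift R (chartLift y t))) ≠ 0 :=
    fun n t => homLift_iterate_ne_zero R _ (hw t)
  have pv : ∀ t, proj (homLift R (chartLift y t)) = sphereMap R (proj (chartLift y t)) :=
    fun t => proj_homLift R (hu t)
  have pw : ∀ t, proj (homLift R (homLift R (chartLift y t))) =
      sphereMap R (sphereMap R (proj (chartLift y t))) :=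
    fun t => by rw [proj_homLift R (hv t), pv]
  have pX : ∀ n t, proj ((homLift R)^[n + 1] (homLift R (homLift R (chartLift y t)))) =
      (sphereMap R)^[n + 1] (sphereMap R (sphereMap R (proj (chartLift y t)))) :=
    fun n t => by rw [proj_homLift_iterate R _ (hw t), pw]
  have du := differentiable_chartLift y
  have dv := (differentiable_homLift R).comp du
  have dw := (differentiable_homLift R).comp dv
  obtain ⟨r, hr, hball⟩ : ∃ r > 0, ∀ t ∈ Metric.ball (0 : ℂ) r,
      sphereMap R (sphereMap R (proj (chartLift y t))) ∈ W := by
    have : (fun p => sphereMap R (sphereMap R p)) ⁻¹' W ∈ 𝓝 y :=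
      (hW.preimage ((continuous_sphereMap R).comp (continuous_sphereMap R))).mem_nhds hq
    rw [← map_proj_chartLift y] at this
    exact Metric.mem_nhds_iff.1 this
  have hnp : ∀ t ∈ Metric.ball (0 : ℂ) r, ∀ n : ℕ,
      (sphereMap R)^[n + 1] (sphereMap R (sphereMap R (proj (chartLift y t)))) ≠
        sphereMap R (sphereMap R (proj (chartLift y t))) := fun t ht n h =>
    hper _ (hball t ht) (Function.mk_mem_periodicPts n.succ_pos h)
  -- Targets y, R(y), R²(y); a coincidence involving y is pushed forward by R², one involving R(y)
  -- but not y by R, so that it becomes a periodicity relation for R²(y).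
  have key := equicontinuousAt_proj (t₀ := 0) hr
    (X := fun (n : ℕ) t => (homLift R)^[n + 1] (homLift R (homLift R (chartLift y t))))
    (fun n => (differentiable_homLift_iterate R (n + 1)).comp dw) du dv dw
    (fun t ht h => by
      rw [Function.comp_apply, ← proj_eq_iff (hu t) (hv t), pv] at h
      exact hnp t ht 0 (congrArg (fun p => sphereMap R (sphereMap R p)) h).symm)
    (fun t ht h => by
      rw [Function.comp_apply, Function.comp_apply, ← proj_eq_iff (hw t) (hu t), pw] at h
      exact hnp t ht 1 (congrArg (fun p => sphereMap R (sphereMap R p)) h))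
    (fun t ht h => by
      rw [Function.comp_apply, Function.comp_apply, ← proj_eq_iff (hw t) (hv t), pw, pv] at h
      exact hnp t ht 0 (congrArg (sphereMap R) h))
    (fun n t ht h => by
      rw [← proj_eq_iff (hX n t) (hu t), pX] at h
      have h' := congrArg (fun p => sphereMap R (sphereMap R p)) h
      simp only [← Function.iterate_succ_apply' (sphereMap R)] at h'
      exact hnp t ht (n + 2) h')
    (fun n t ht h => by
      rw [Function.comp_apply, ← proj_eq_iff (hX n t) (hv t), pX, pv] at h
      have h' := congrArg (sphereMap R) h
      simp only [← Function.iterate_succ_apply' (sphereMap R)] at h'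
      exact hnp t ht (n + 1) h')
    (fun n t ht h => by
      rw [Function.comp_apply, Function.comp_apply, ← proj_eq_iff (hX n t) (hw t), pX, pw] at h
      exact hnp t ht n h)
  simp only [pX] at key
  intro V hV
  have hV' := key V hV
  simp only [proj_chartLift_zero] at hV'
  -- Openness of R at y and at R(y): images of parameter neighbourhoods are neighbourhoods of R²(y).
  have hle : 𝓝 (sphereMap R (sphereMap R y)) ≤
      map (fun t => sphereMap R (sphereMap R (proj (chartLift y t)))) (𝓝 0) := by
    calc 𝓝 (sphereMap R (sphereMap R y)) ≤ map (sphereMap R) (map (sphereMap R) (𝓝 y)) :=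
          (nhds_sphereMap_le hR _).trans (map_mono (nhds_sphereMap_le hR _))
      _ = _ := by rw [← map_proj_chartLift y, map_map, map_map]; rfl
  exact hle hV'

/-- Arzelà–Ascoli on a compact neighbourhood `K` of `z`: a subsequence converges uniformly on `K`,
hence on every compact subset of its interior. -/
theorem mem_fatouSet_of_equicontinuousAt {R : RatFunc ℂ} {W : Set RiemannSphere} (hW : IsOpen W)
    (heq : ∀ q ∈ W, EquicontinuousAt (fun (n : ℕ) p => (sphereMap R)^[n + 1] p) q)
    {z : RiemannSphere} (hz : z ∈ W) : z ∈ fatouSet R := by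
  obtain ⟨K, hK, hzK, hKW⟩ := exists_compact_subset hW hz
  refine ⟨interior K, isOpen_interior, hzK, fun f hf => ?_⟩
  have : CompactSpace K := isCompact_iff_compactSpace.1 hK
  have hf' : ∀ n, ∃ m : ℕ, f n = (sphereMap R)^[m + 1] := fun n => by
    obtain ⟨m, hm, h⟩ := hf n
    exact ⟨m - 1, by rw [h, Nat.sub_add_cancel hm]⟩
  choose m hm using hf'
  have hcont : ∀ n, Continuous fun x : K => f n x := fun n => by
    rw [hm n]
    exact ((continuous_sphereMap R).iterate _).comp continuous_subtype_val
  set F : ℕ → BoundedContinuousFunction K RiemannSphere := fun n =>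
    BoundedContinuousFunction.mkOfCompact ⟨fun x => f n x, hcont n⟩ with hF
  have hcomp : IsCompact (closure (Set.range F)) := by
    refine BoundedContinuousFunction.arzela_ascoli Set.univ isCompact_univ _
      (fun _ _ _ => trivial) fun x V hV => ?_
    have h1 := heq x (hKW x.2) V hV
    filter_upwards [continuous_subtype_val.continuousAt.eventually h1] with w hw
    rintro ⟨_, n, rfl⟩
    have := hw (m n)
    rw [← hm n] at this
    exact this
  obtain ⟨G, -, φ, hφ, hlim⟩ := hcomp.tendsto_subseq fun n => subset_closure ⟨n, rfl⟩
  classical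
  refine ⟨φ, hφ, fun w => if h : w ∈ K then G ⟨w, h⟩ else ∞, fun L hL _ ε hε => ?_⟩
  obtain ⟨N, hN⟩ := Metric.tendsto_atTop.1 hlim ε hε
  refine ⟨N, fun j hj w hw => ?_⟩
  have hwK : w ∈ K := interior_subset (hL hw)
  simp only [dif_pos hwK]
  exact (BoundedContinuousFunction.dist_coe_le_dist (⟨w, hwK⟩ : K)).trans_lt (hN j hj)

end RationalDynamics

theorem theorem1p5p15 (R : RatFunc ℂ) (hR : 2 ≤ RationalDynamics.mapDegree R) :
    RationalDynamics.juliaSet R ⊆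
      closure (Function.periodicPts (RationalDynamics.sphereMap R)) := by
  intro z hz
  by_contra hcl
  refine hz (RationalDynamics.mem_fatouSet_of_equicontinuousAt (isClosed_closure.isOpen_compl)
    (fun q hq => RationalDynamics.equicontinuousAt_iterates (by omega) isClosed_closure.isOpen_compl
      (fun p hp hper => hp (subset_closure hper)) hq) hcl)
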